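/- Conventions. For a finite connected simple graph $G$, write $|G|$ for its number of vertices, $d_{uv}$ for the graph distance, and $\mathcal W_G=\frac12\sum_{u,v}d_{uv}$ for its Wiener index (sum over ordered pairs of vertices). For the simple random walk on $G$ (at each step the walker moves to a uniformly chosen neighbour), let $\mathcal H_{u\to v}$ be the expected time at which the walk started at $u$ first reaches $v$ (so $\mathcal H_{u\to u}=0$). The mean hitting time is $\langle\mathcal H_G\rangle=\frac{1}{|G|(|G|-1)}\sum_{u,v}\mathcal H_{u\to v}$ (read as $0$ if $|G|=1$). If every vertex degree $k_u$ of $G$ is at most $m$, the $m$-order V-fractal operation on $G$ places two new vertices on each edge (each edge becomes a path of length $3$) and attaches $m-k_u$ new leaves to each vertex $u$ of $G$, where $k_u$ is the degree of $u$ in $G$. Proposition I.14. Let $T$ be an arbitrary finite tree with $n$ vertices, let $m,t\ge 0$ be integers, and let $T^V_m(0)=T$, with $T^V_m(s+1)$ the result of applying the $m$-order V-fractal operation to $T^V_m(s)$. Assume that the operation is applicable in each of the $t$ steps, that is, that $T^V_m(s)$ has maximum degree at most $m$ for every $0\le s<t$ (for $m\ge 2$ it suffices that $T$ has maximum degree at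 most $m$). Then $|T^V_m(t)|=n(m+1)^t$, all hitting times on $T^V_m(t)$ are finite, and $$\langle\mathcal H_{T^V_m(t)}\rangle=\frac{2}{|T^V_m(t)|}\left\{f_5^{\,t}\,\mathcal W_T+g_5\sum_{i=0}^{t-1}f_5^{\,i}\,|T^V_m(t-1-i)|^2+h_5\sum_{i=0}^{t-1}f_5^{\,i}\,|T^V_m(t-1-i)|\right\},$$ where $f_5=3(m+1)^2$, $g_5=(m-2)(m+1)$ and $h_5=m+2$. -/

import Mathlib

open MeasureTheory ProbabilityTheory
open scoped ENNReal

universe u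

/-- A finite simple graph, bundled with its vertex type (the vertex type grows when an operation
is applied to the graph). -/
structure FinGraph : Type (u + 1) where
  /-- the vertex type -/
  V : Type u
  /-- there are finitely many vertices -/
  [fintypeV : Fintype V]
  /-- the graph -/
  graph : SimpleGraph V

namespace FinGraph

instance instFintypeV (G : FinGraph.{u}) : Fintype G.V := G.fintypeV

instance instMeasurableSpaceV (G : FinGraph.{u}) : MeasurableSpace G.V := ⊤

instance instDiscreteMeasurableSpaceV (G : FinGraph.{u}) : DiscreteMeasurableSpace G.V where
  forall_measurableSet _ := MeasurableSpace.measurableSet_top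

/-- The number of vertices. -/
def order (G : FinGraph.{u}) : ℕ := Fintype.card G.V

open Classical in
/-- The degree of a vertex. -/
noncomputable def deg (G : FinGraph.{u}) (u : G.V) : ℕ := G.graph.degree u

/-! ### Wiener index -/

/-- The Wiener index: half of the sum of the distances over all ordered pairs of vertices. -/
noncomputable def wiener (G : FinGraph.{u}) : ℝ :=
  (1 / 2) * ∑ u : G.V, ∑ v : G.V, (G.graph.dist u v : ℝ)

/-! ### Random walk and hitting times -/

open Classical in
/-- One step of the unbiased random walk from `u`: a uniformly chosen neighbour of `u`. (A vertex
without neighbours occurs in a connected graph only if it is the only vertex; the walk stays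
there.) -/
noncomputable def stepLaw (G : FinGraph.{u}) (u : G.V) : PMF G.V :=
  if h : (G.graph.neighborFinset u).Nonempty then
    PMF.uniformOfFinset (G.graph.neighborFinset u) h
  else PMF.pure u

/-- The transition kernel of the random walk. -/
noncomputable def stepKernel (G : FinGraph.{u}) : Kernel G.V G.V where
  toFun u := (G.stepLaw u).toMeasure
  measurable' := measurable_from_top

instance instIsMarkovKernelStepKernel (G : FinGraph.{u}) : IsMarkovKernel G.stepKernel :=
  ⟨fun u => inferInstanceAs (IsProbabilityMeasure (G.stepLaw u).toMeasure)⟩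

/-- The kernel that chooses the position at time `k + 1` from the positions at the times
`0, …, k`: it uses the position at time `k` only. -/
noncomputable def pathKernel (G : FinGraph.{u}) (k : ℕ) :
    Kernel ((i : Finset.Iic k) → (fun _ : ℕ => G.V) i) G.V :=
  G.stepKernel.comap (fun x => x ⟨k, Finset.mem_Iic.2 le_rfl⟩) (measurable_pi_apply _)

instance instIsMarkovKernelPathKernel (G : FinGraph.{u}) (k : ℕ) :
    IsMarkovKernel (G.pathKernel k) :=
  inferInstanceAs (IsMarkovKernel (G.stepKernel.comap _ _))

/-- The law, on the space of trajectories `ℕ → G.V`, of the random walk that starts at `u`. -/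
noncomputable def walkLaw (G : FinGraph.{u}) (u : G.V) : Measure (ℕ → G.V) :=
  Kernel.traj (X := fun _ : ℕ => G.V) G.pathKernel 0 (fun _ => u)

/-- The first time at which the trajectory `ω` is at `v` (`∞` if it never is). -/
noncomputable def firstTime (G : FinGraph.{u}) (v : G.V) (ω : ℕ → G.V) : ℝ≥0∞ :=
  ⨅ (k : ℕ) (_ : ω k = v), (k : ℝ≥0∞)

/-- The hitting time from `u` to `v`: the expected time at which the random walk that starts at `u`
first reaches `v`. -/
noncomputable def hittingTime (G : FinGraph.{u}) (u v : G.V) : ℝ≥0∞ :=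
  ∫⁻ ω, G.firstTime v ω ∂(G.walkLaw u)

/-- The mean hitting time: the average of the hitting times over the ordered pairs of distinct
vertices (the hitting time from a vertex to itself is `0`). -/
noncomputable def meanHittingTime (G : FinGraph.{u}) : ℝ :=
  (∑ u : G.V, ∑ v : G.V, (G.hittingTime u v).toReal) / ((G.order : ℝ) * ((G.order : ℝ) - 1))

/-! ### The V-fractal operation -/

/-- The vertices after the V-fractal operation of order `m`: the old vertices, two new vertices for
each edge (one for each orientation `(u, v)` of the edge, which is the one placed next to `u`), and
`m - deg u` new vertices for each old vertex `u`. -/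
inductive VVertex (G : FinGraph.{u}) (m : ℕ) : Type u
  | old (u : G.V) : VVertex G m
  | mid (d : G.graph.Dart) : VVertex G m
  | leaf (u : G.V) (i : Fin (m - G.deg u)) : VVertex G m

/-- The vertices after the operation, as a sum type. -/
def vVertexEquiv (G : FinGraph.{u}) (m : ℕ) :
    VVertex G m ≃ G.V ⊕ G.graph.Dart ⊕ (Σ u : G.V, Fin (m - G.deg u)) where
  toFun
    | .old u => Sum.inl u
    | .mid d => Sum.inr (Sum.inl d)
    | .leaf u i => Sum.inr (Sum.inr ⟨u, i⟩)
  invFun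
    | Sum.inl u => .old u
    | Sum.inr (Sum.inl d) => .mid d
    | Sum.inr (Sum.inr ⟨u, i⟩) => .leaf u i
  left_inv x := by cases x <;> rfl
  right_inv x := by rcases x with _ | _ | ⟨_, _⟩ <;> rfl

open Classical in
noncomputable instance instFintypeVVertex (G : FinGraph.{u}) (m : ℕ) : Fintype (VVertex G m) :=
  Fintype.ofEquiv _ (G.vVertexEquiv m).symm

/-- Adjacency after the V-fractal operation: each edge `{u, v}` is replaced by the path
`u, mid (u, v), mid (v, u), v`, and the new vertices `leaf u i` are joined to `u`. -/
def VAdj (G : FinGraph.{u}) (m : ℕ) : VVertex G m → VVertex G m → Prop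
  | .old u, .mid d => d.fst = u
  | .mid d, .old u => d.fst = u
  | .mid d, .mid e => e = d.symm
  | .old u, .leaf v _ => u = v
  | .leaf v _, .old u => u = v
  | _, _ => False

/-- The graph that results from the V-fractal operation of order `m`. -/
def vGraph (G : FinGraph.{u}) (m : ℕ) : SimpleGraph (VVertex G m) where
  Adj := G.VAdj m
  symm := ⟨by
    rintro (u | d | ⟨u, i⟩) (v | e | ⟨v, j⟩) h <;> simp_all [VAdj]⟩
  loopless := ⟨by
    rintro (u | d | ⟨u, i⟩) h
    · exact h
    · exact d.symm_ne h.symm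
    · exact h⟩

/-- The V-fractal operation of order `m`, as a map on finite graphs. -/
noncomputable def vOp (m : ℕ) (G : FinGraph.{u}) : FinGraph.{u} where
  V := VVertex G m
  graph := G.vGraph m

/-- The V-fractal operation of order `m` may be applied to `G`: no vertex has a degree greater than
`m`. -/
def VApplicable (m : ℕ) (G : FinGraph.{u}) : Prop := ∀ u : G.V, G.deg u ≤ m

/-- The generalized V-fractal after `t` time steps with seed `G`. -/
noncomputable def vFractal (m : ℕ) (G : FinGraph.{u}) : ℕ → FinGraph.{u}
  | 0 => G
  | t + 1 => vOp m (vFractal m G t)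

end FinGraph

/-!
Removing an edge `{a, b}` of a tree on `n` vertices leaves two sides, of sizes `A` and `B` with
`A + B = n`. The walk needs `2 * A - 1` steps on average to go from `a` to `b`, and both the
distance and the hitting time from `u` to `v` add up along the path, that is, over the edges that
separate `u` from `v`. Summing over all pairs weights each edge by `A * B`: the Wiener index is the
sum of `A * B` over the edges, and the hitting times, where the two orientations contribute
`(2 * A - 1) + (2 * B - 1) = 2 * (n - 1)`, add up to `2 * (n - 1)` times as much. The mean hitting
time of a tree is therefore `2 / n` times its Wiener index.

The V-fractal operation surrounds each old vertex `u` by a cluster of `m + 1` vertices: `u`, its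
`deg u` neighbours on subdivided edges, and its `m - deg u` leaves. With `N = m + 1`, an old edge
with sides `A` and `B` becomes three edges with sides `N * A` and `N * B`, `N * A - 1` and
`N * B + 1`, `N * A + 1` and `N * B - 1`, and each new leaf splits off a single vertex. Adding up
the products gives the recursion `W ↦ 3 * N ^ 2 * W + (m - 2) * N * n ^ 2 + (m + 2) * n` for the
Wiener index.
-/

/-! ### Edge sides -/

section EdgeSide

variable {V : Type*} {G : SimpleGraph V} {u v w x y : V} {S : Set V}

theorem mem_of_forall_adj_mem (hG : G.Preconnected) (hS : ∀ ⦃p q⦄, G.Adj p q → p ∈ S → q ∈ S)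
    (hv : v ∈ S) (w : V) : w ∈ S := by
  by_contra hw
  obtain ⟨p⟩ := hG v w
  obtain ⟨d, -, hfst, hsnd⟩ := p.exists_boundary_dart S hv hw
  exact hsnd (hS d.adj hfst)

/-- `S` contains `u` but not `v`, and no edge other than the one from `u` to `v` leaves `S`. In a
connected graph this determines `S`: it is the side of `u` when the edge is removed. -/
structure IsEdgeSide (G : SimpleGraph V) (u v : V) (S : Set V) : Prop where
  left_mem : u ∈ S
  right_notMem : v ∉ S
  eq_of_exit : ∀ ⦃p q⦄, G.Adj p q → p ∈ S → q ∉ S → p = u ∧ q = v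

/-- The vertices that can be reached from `u` without using the edge `{u, v}`. -/
def edgeSide (G : SimpleGraph V) (u v : V) : Set V :=
  {w | (G.deleteEdges {s(u, v)}).Reachable u w}

/-- For an edge `{u, v}` of a tree, the number of pairs of vertices, the first on the side of `u`
and the second on the side of `v`, whose path uses the edge. -/
noncomputable def edgeSplit (G : SimpleGraph V) (u v : V) : ℝ :=
  (edgeSide G u v).ncard * (edgeSide G v u).ncard

theorem edgeSplit_comm (G : SimpleGraph V) (u v : V) : edgeSplit G u v = edgeSplit G v u :=
  mul_comm _ _

namespace IsEdgeSide

theorem compl (h : IsEdgeSide G u v S) : IsEdgeSide G v u Sᶜ where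
  left_mem := h.right_notMem
  right_notMem := not_not_intro h.left_mem
  eq_of_exit _ _ hadj hp hq := (h.eq_of_exit hadj.symm (not_not.1 hq) hp).symm

theorem isBridge (h : IsEdgeSide G u v S) : G.IsBridge s(u, v) := by
  rw [SimpleGraph.isBridge_iff]
  rintro ⟨p⟩
  obtain ⟨d, -, hfst, hsnd⟩ := p.exists_boundary_dart S h.left_mem h.right_notMem
  have hadj := SimpleGraph.deleteEdges_adj.1 d.adj
  obtain ⟨hu, hv⟩ := h.eq_of_exit hadj.1 hfst hsnd
  exact hadj.2 (by rw [hu, hv]; rfl)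

theorem subset {A : Set V} (hS : IsEdgeSide G u v S) (hA : IsEdgeSide G u v A)
    (hG : G.Preconnected) : S ⊆ A := by
  intro w hw
  by_contra hwA
  have hclosed : ∀ ⦃p q⦄, G.Adj p q → p ∈ S \ A → q ∈ S \ A := by
    intro p q hadj hp
    refine ⟨by_contra fun hq => hp.2 ?_, fun hq => hS.right_notMem ?_⟩
    · exact (hS.eq_of_exit hadj hp.1 hq).1 ▸ hA.left_mem
    · exact (hA.eq_of_exit hadj.symm hq hp.2).2 ▸ hp.1
  exact (mem_of_forall_adj_mem hG hclosed ⟨hw, hwA⟩ u).2 hA.left_mem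

end IsEdgeSide

theorem isEdgeSide_edgeSide (h : G.IsBridge s(u, v)) : IsEdgeSide G u v (edgeSide G u v) where
  left_mem := SimpleGraph.Reachable.refl u
  right_notMem := h
  eq_of_exit p q hadj hp hq := by
    have hedge : s(p, q) = s(u, v) := by
      by_contra hne
      have hadj' : (G.deleteEdges {s(u, v)}).Adj p q := SimpleGraph.deleteEdges_adj.2 ⟨hadj, hne⟩
      exact hq (hp.trans hadj'.reachable)
    rcases Sym2.eq_iff.1 hedge with heq | ⟨rfl, rfl⟩
    · exact heq
    · exact absurd hp h

theorem IsEdgeSide.edgeSide_eq (h : IsEdgeSide G u v S) (hG : G.Preconnected) :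
    edgeSide G u v = S :=
  ((isEdgeSide_edgeSide h.isBridge).subset h hG).antisymm
    (h.subset (isEdgeSide_edgeSide h.isBridge) hG)

theorem isEdgeSide_edgeSide_of_isAcyclic (hG : G.IsAcyclic) (h : G.Adj u v) :
    IsEdgeSide G u v (edgeSide G u v) :=
  isEdgeSide_edgeSide (SimpleGraph.isAcyclic_iff_forall_adj_isBridge.1 hG h)

theorem edgeSide_swap (hG : G.IsTree) (h : G.Adj u v) : edgeSide G v u = (edgeSide G u v)ᶜ :=
  (isEdgeSide_edgeSide_of_isAcyclic hG.isAcyclic h).compl.edgeSide_eq hG.connected.preconnected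

theorem mem_edgeSide_of_isPath_cons (hG : G.IsTree) (h : G.Adj u x) {q : G.Walk x v}
    (hq : (q.cons h).IsPath) : v ∈ edgeSide G x u := by
  by_contra hv
  have hside := isEdgeSide_edgeSide_of_isAcyclic hG.isAcyclic h.symm
  obtain ⟨d, hd, hfst, hsnd⟩ := q.exists_boundary_dart _ hside.left_mem hv
  have hu := (hside.eq_of_exit d.adj hfst hsnd).2
  exact ((SimpleGraph.Walk.cons_isPath_iff h q).1 hq).2
    (hu ▸ q.dart_snd_mem_support_of_mem_darts hd)

theorem existsUnique_adj_mem_edgeSide (hG : G.IsTree) (hw : w ≠ u) :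
    ∃! x, G.Adj u x ∧ w ∈ edgeSide G x u := by
  have hside {x : V} (h : G.Adj u x) := isEdgeSide_edgeSide_of_isAcyclic hG.isAcyclic h.symm
  obtain ⟨p, hp⟩ := hG.connected.exists_isPath u w
  cases p with
  | nil => exact absurd rfl hw
  | @cons _ x _ h q =>
    refine ⟨x, ⟨h, mem_edgeSide_of_isPath_cons hG h hp⟩, ?_⟩
    rintro y ⟨hy, hwy⟩
    by_contra hne
    have hclosed : ∀ ⦃a b⦄, G.Adj a b → a ∈ edgeSide G x u ∩ edgeSide G y u →
        b ∈ edgeSide G x u ∩ edgeSide G y u := by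
      rintro a b hadj ⟨hax, hay⟩
      refine ⟨by_contra fun hb => hne ?_, by_contra fun hb => hne ?_⟩
      · obtain ⟨rfl, rfl⟩ := (hside h).eq_of_exit hadj hax hb
        exact ((hside hy).eq_of_exit hadj hay (hside hy).right_notMem).1.symm
      · obtain ⟨rfl, rfl⟩ := (hside hy).eq_of_exit hadj hay hb
        exact ((hside h).eq_of_exit hadj hax (hside h).right_notMem).1
    exact (hside h).right_notMem (mem_of_forall_adj_mem hG.connected.preconnected hclosed
      ⟨mem_edgeSide_of_isPath_cons hG h hp, hwy⟩ u).1

section Fintype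

variable [Fintype V]

theorem sum_indicator_one (S : Set V) : ∑ w, S.indicator (1 : V → ℝ) w = S.ncard := by
  classical
  simp [Set.indicator_apply, Set.ncard_eq_toFinset_card']

theorem IsEdgeSide.edgeSplit_eq (h : IsEdgeSide G u v S) (hG : G.Preconnected) :
    edgeSplit G u v = S.ncard * (Fintype.card V - S.ncard) := by
  have hcard : (S.ncard : ℝ) + Sᶜ.ncard = Fintype.card V := by
    rw [← Nat.card_eq_fintype_card]
    exact_mod_cast Set.ncard_add_ncard_compl S
  rw [edgeSplit, h.edgeSide_eq hG, h.compl.edgeSide_eq hG, ← hcard, add_sub_cancel_left]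

theorem ncard_edgeSide_add (hG : G.IsTree) (h : G.Adj u v) :
    ((edgeSide G u v).ncard : ℝ) + (edgeSide G v u).ncard = Fintype.card V := by
  rw [edgeSide_swap hG h, ← Nat.card_eq_fintype_card]
  exact_mod_cast Set.ncard_add_ncard_compl _

variable [DecidableRel G.Adj]

theorem sum_neighborFinset_indicator_edgeSide (hG : G.IsTree) (hw : w ≠ u) :
    ∑ x ∈ G.neighborFinset u, (edgeSide G x u).indicator (1 : V → ℝ) w = 1 := by
  obtain ⟨x, ⟨hadj, hmem⟩, huniq⟩ := existsUnique_adj_mem_edgeSide hG hw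
  rw [Finset.sum_eq_single_of_mem x ((G.mem_neighborFinset u x).2 hadj), Set.indicator_of_mem hmem,
    Pi.one_apply]
  intro y hy hne
  exact Set.indicator_of_notMem
    (fun hwy => hne (huniq y ⟨(G.mem_neighborFinset u y).1 hy, hwy⟩)) _

theorem sum_neighborFinset_ncard_edgeSide (hG : G.IsTree) (u : V) :
    ∑ x ∈ G.neighborFinset u, ((edgeSide G x u).ncard : ℝ) = Fintype.card V - 1 := by
  classical
  have hself : ∑ x ∈ G.neighborFinset u, (edgeSide G x u).indicator (1 : V → ℝ) u = 0 :=
    Finset.sum_eq_zero fun x hx => Set.indicator_of_notMem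
      (isEdgeSide_edgeSide_of_isAcyclic hG.isAcyclic
        ((G.mem_neighborFinset u x).1 hx).symm).right_notMem _
  simp only [← sum_indicator_one]
  rw [Finset.sum_comm, ← Finset.add_sum_erase _ _ (Finset.mem_univ u), hself, zero_add,
    Finset.sum_congr rfl fun w hw =>
      sum_neighborFinset_indicator_edgeSide hG (Finset.ne_of_mem_erase hw),
    Finset.sum_const, Finset.card_erase_of_mem (Finset.mem_univ u), Finset.card_univ,
    nsmul_one, Nat.cast_pred (Fintype.card_pos_iff.2 ⟨u⟩)]

/-! ### Sums along paths -/

/-- For a tree, the sum of the weights `c a b` of the edges `(a, b)` traversed by the path from `u`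
to `v`. These are the edges that have `u` on the side of `a` and `v` on the side of `b`, so no path
has to be chosen. -/
noncomputable def pathSum (G : SimpleGraph V) [DecidableRel G.Adj] (c : V → V → ℝ) (u v : V) : ℝ :=
  ∑ d : G.Dart, (edgeSide G d.fst d.snd).indicator 1 u * (edgeSide G d.snd d.fst).indicator 1 v *
    c d.fst d.snd

variable {c : V → V → ℝ}

theorem pathSum_self (hG : G.IsTree) (c : V → V → ℝ) (u : V) : pathSum G c u u = 0 :=
  Finset.sum_eq_zero fun d _ => by
    rw [edgeSide_swap hG d.adj, Set.indicator_compl]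
    by_cases hu : u ∈ edgeSide G d.fst d.snd <;> simp [hu]

theorem pathSum_nonneg (hc : ∀ a b, G.Adj a b → 0 ≤ c a b) (u v : V) : 0 ≤ pathSum G c u v :=
  Finset.sum_nonneg fun d _ => mul_nonneg
    (mul_nonneg (Set.indicator_nonneg (fun _ _ => zero_le_one) _)
      (Set.indicator_nonneg (fun _ _ => zero_le_one) _)) (hc _ _ d.adj)

theorem pathSum_eq_add (hG : G.IsTree) (h : G.Adj u x) (hv : v ∈ edgeSide G x u) :
    pathSum G c u v = c u x + pathSum G c x v := by
  classical
  have hside (d : G.Dart) := isEdgeSide_edgeSide_of_isAcyclic hG.isAcyclic d.adj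
  let e : G.Dart := ⟨(u, x), h⟩
  have hterm (d : G.Dart) :
      (edgeSide G d.fst d.snd).indicator 1 u * (edgeSide G d.snd d.fst).indicator 1 v *
          c d.fst d.snd = (if d = e then c u x else 0) +
        (edgeSide G d.fst d.snd).indicator 1 x * (edgeSide G d.snd d.fst).indicator 1 v *
          c d.fst d.snd := by
    by_cases hd : d = e
    · subst hd
      simp [e, hv, (hside e).left_mem, (hside e).right_notMem]
    rw [if_neg hd, zero_add]
    by_cases hd' : d = e.symm
    · subst hd'
      have hvu : v ∉ edgeSide G u x := edgeSide_swap hG h.symm ▸ not_not_intro hv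
      simp [e, hvu]
    have hiff : u ∈ edgeSide G d.fst d.snd ↔ x ∈ edgeSide G d.fst d.snd := by
      refine ⟨fun hu => by_contra fun hx => hd ?_, fun hx => by_contra fun hu => hd' ?_⟩
      · obtain ⟨h₁, h₂⟩ := (hside d).eq_of_exit h hu hx
        exact SimpleGraph.Dart.ext _ _ (Prod.ext h₁.symm h₂.symm)
      · obtain ⟨h₁, h₂⟩ := (hside d).eq_of_exit h.symm hx hu
        exact SimpleGraph.Dart.ext _ _ (Prod.ext h₁.symm h₂.symm)
    simp only [Set.indicator_apply, hiff, Pi.one_apply]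
  rw [pathSum, Finset.sum_congr rfl fun d _ => hterm d, Finset.sum_add_distrib,
    Finset.sum_ite_eq' Finset.univ e, if_pos (Finset.mem_univ e)]
  rfl

theorem pathSum_one_eq_dist (hG : G.IsTree) (u v : V) :
    pathSum G (fun _ _ => 1) u v = G.dist u v := by
  have heq : ∀ {u v : V} (p : G.Walk u v), p.IsPath →
      pathSum G (fun _ _ => 1) u v = p.length := by
    intro u v p hp
    induction p with
    | nil => rw [pathSum_self hG, SimpleGraph.Walk.length_nil, Nat.cast_zero]
    | cons h q ih =>
      rw [pathSum_eq_add hG h (mem_edgeSide_of_isPath_cons hG h hp), ih hp.of_cons,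
        SimpleGraph.Walk.length_cons]
      push_cast
      ring
  obtain ⟨p, hp, hlength⟩ := hG.connected.exists_path_of_dist u v
  rw [heq p hp, hlength]

theorem sum_pathSum (G : SimpleGraph V) [DecidableRel G.Adj] (c : V → V → ℝ) :
    ∑ u, ∑ v, pathSum G c u v = ∑ d : G.Dart, edgeSplit G d.fst d.snd * c d.fst d.snd := by
  simp only [pathSum, edgeSplit]
  rw [Finset.sum_congr rfl fun u _ => Finset.sum_comm, Finset.sum_comm]
  refine Finset.sum_congr rfl fun d _ => ?_
  rw [← sum_indicator_one, ← sum_indicator_one, Finset.sum_mul_sum, Finset.sum_mul]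
  exact Finset.sum_congr rfl fun u _ => (Finset.sum_mul _ _ _).symm

end Fintype

end EdgeSide
namespace FinGraph

/-! ### First-step analysis of hitting times -/

section FirstStep

variable (G : FinGraph.{u})

/-- The trajectories that do not visit `v` up to time `n`. -/
def avoiding (v : G.V) (n : ℕ) : Set (ℕ → G.V) := {ω | ∀ i ≤ n, ω i ≠ v}

theorem measurableSet_avoiding (v : G.V) (n : ℕ) : MeasurableSet (G.avoiding v n) := by
  simp only [avoiding, Set.ofPred_forall]
  exact .iInter fun i => .iInter fun _ =>
    MeasurableSet.preimage (t := {v}ᶜ) .of_discrete (measurable_pi_apply i)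

theorem firstTime_eq_tsum_indicator (v : G.V) (ω : ℕ → G.V) :
    G.firstTime v ω = ∑' n, (G.avoiding v n).indicator 1 ω := by
  classical
  by_cases h : ∃ k, ω k = v
  · have mem_avoiding_iff (n : ℕ) : ω ∈ G.avoiding v n ↔ n ∈ Finset.range (Nat.find h) := by
      rw [Finset.mem_range, Nat.lt_find_iff]
      rfl
    have firstTime_eq : G.firstTime v ω = Nat.find h :=
      le_antisymm (iInf₂_le (f := fun k (_ : ω k = v) => (k : ℝ≥0∞)) _ (Nat.find_spec h))
        (le_iInf₂ fun k hk => Nat.cast_le.2 (Nat.find_min' h hk))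
    rw [firstTime_eq, tsum_eq_sum (s := Finset.range (Nat.find h)) fun n hn =>
      Set.indicator_of_notMem (mt (mem_avoiding_iff n).1 hn) _,
      Finset.sum_congr rfl fun n hn => Set.indicator_of_mem ((mem_avoiding_iff n).2 hn) _]
    simp
  · push Not at h
    simp [firstTime, avoiding, h]

theorem hittingTime_eq_tsum_walkLaw_avoiding (u v : G.V) :
    G.hittingTime u v = ∑' n, G.walkLaw u (G.avoiding v n) := by
  simp only [hittingTime, firstTime_eq_tsum_indicator]
  rw [lintegral_tsum fun n =>
    (measurable_one.indicator (G.measurableSet_avoiding v n)).aemeasurable]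
  exact tsum_congr fun n => lintegral_indicator_one (G.measurableSet_avoiding v n)

theorem walkLaw_map_eval_zero (u : G.V) :
    (G.walkLaw u).map (fun ω => ω 0) = Measure.dirac u := by
  have hlast : Measurable fun z : Finset.Iic 0 → G.V => z ⟨0, Finset.mem_Iic.2 le_rfl⟩ :=
    measurable_pi_apply _
  change (G.walkLaw u).map
    ((fun z : Finset.Iic 0 → G.V => z ⟨0, Finset.mem_Iic.2 le_rfl⟩) ∘ Preorder.frestrictLe 0) = _
  rw [← Measure.map_map hlast (Preorder.measurable_frestrictLe 0), walkLaw,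
    Kernel.traj_map_frestrictLe_apply, Kernel.partialTraj_self, Kernel.id_apply]
  exact Measure.map_dirac' hlast _

/-- The Markov property: given the history up to time `n`, the position at time `n + 1` is a step
from the position at time `n`. -/
theorem setLIntegral_walkLaw_succ (u : G.V) (n : ℕ) {A : Set (Finset.Iic n → G.V)}
    (hA : MeasurableSet A) (φ : G.V → ℝ≥0∞) :
    ∫⁻ ω in Preorder.frestrictLe n ⁻¹' A, φ (ω (n + 1)) ∂(G.walkLaw u) =
      ∫⁻ ω in Preorder.frestrictLe n ⁻¹' A, ∫⁻ y, φ y ∂(G.stepKernel (ω n)) ∂(G.walkLaw u) := by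
  have hφ : Measurable fun p : (Finset.Iic n → G.V) × G.V => φ p.2 :=
    (Measurable.of_discrete (f := φ)).comp measurable_snd
  have hstep : Measurable fun x => ∫⁻ y, φ y ∂(G.stepKernel x) := .of_discrete
  have hlast : Measurable fun z : Finset.Iic n → G.V => z ⟨n, Finset.mem_Iic.2 le_rfl⟩ :=
    measurable_pi_apply _
  calc ∫⁻ ω in Preorder.frestrictLe n ⁻¹' A, φ (ω (n + 1)) ∂(G.walkLaw u)
      = ∫⁻ p in A ×ˢ Set.univ, φ p.2
          ∂((G.walkLaw u).map fun ω => (Preorder.frestrictLe n ω, ω (n + 1))) := by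
        rw [setLIntegral_map (hA.prod .univ) hφ (by fun_prop),
          Set.prod_univ]
        rfl
    _ = ∫⁻ z in A, ∫⁻ y, φ y ∂(G.pathKernel n z) ∂((G.walkLaw u).map (Preorder.frestrictLe n)) := by
        rw [walkLaw, ← Kernel.partialTraj_compProd_eq_map_traj (Nat.zero_le n),
          Measure.setLIntegral_compProd hφ hA .univ,
          Kernel.traj_map_frestrictLe_apply]
        simp only [Measure.restrict_univ]
    _ = _ := setLIntegral_map hA (hstep.comp hlast) (Preorder.measurable_frestrictLe n)

variable {G} {v : G.V} {F : G.V → ℝ≥0∞}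

theorem setLIntegral_avoiding_eq_add (hv : F v = 0)
    (hF : ∀ x ≠ v, F x = 1 + ∫⁻ y, F y ∂(G.stepKernel x)) (u : G.V) (n : ℕ) :
    ∫⁻ ω in G.avoiding v n, F (ω n) ∂(G.walkLaw u) = G.walkLaw u (G.avoiding v n) +
      ∫⁻ ω in G.avoiding v (n + 1), F (ω (n + 1)) ∂(G.walkLaw u) := by
  have hmeas := G.measurableSet_avoiding v
  have hsupp : F.support ⊆ {v}ᶜ := Set.subset_compl_singleton_iff.2 fun h => h hv
  have havoid : G.avoiding v n =
      Preorder.frestrictLe n ⁻¹' (Set.univ.pi fun _ => ({v}ᶜ : Set G.V)) := by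
    ext ω
    simp [avoiding, Preorder.frestrictLe]
  have hsucc : ∫⁻ ω in G.avoiding v n, F (ω (n + 1)) ∂(G.walkLaw u) =
      ∫⁻ ω in G.avoiding v (n + 1), F (ω (n + 1)) ∂(G.walkLaw u) := by
    have hinter : G.avoiding v (n + 1) =
        Function.eval (n + 1) ⁻¹' ({v}ᶜ : Set G.V) ∩ G.avoiding v n := by
      ext ω
      simp [avoiding, Nat.le_succ_iff, or_imp, forall_and, and_comm]
    rw [hinter, ← Measure.restrict_restrict (measurable_pi_apply (n + 1) .of_discrete)]
    exact (setLIntegral_eq_of_support_subset (Set.preimage_mono hsupp)).symm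
  calc ∫⁻ ω in G.avoiding v n, F (ω n) ∂(G.walkLaw u)
      = ∫⁻ ω in G.avoiding v n, (1 + ∫⁻ y, F y ∂(G.stepKernel (ω n))) ∂(G.walkLaw u) :=
        setLIntegral_congr_fun (hmeas n) fun ω hω => hF _ (hω n le_rfl)
    _ = G.walkLaw u (G.avoiding v n) +
          ∫⁻ ω in G.avoiding v n, ∫⁻ y, F y ∂(G.stepKernel (ω n)) ∂(G.walkLaw u) := by
        rw [lintegral_add_left measurable_const, setLIntegral_one]
    _ = _ := by
        rw [← hsucc, havoid, setLIntegral_walkLaw_succ _ u n (.univ_pi fun _ => .of_discrete)]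

theorem eq_sum_walkLaw_avoiding_add (hv : F v = 0)
    (hF : ∀ x ≠ v, F x = 1 + ∫⁻ y, F y ∂(G.stepKernel x)) (u : G.V) (n : ℕ) :
    F u = ∑ k ∈ Finset.range n, G.walkLaw u (G.avoiding v k) +
      ∫⁻ ω in G.avoiding v n, F (ω n) ∂(G.walkLaw u) := by
  induction n with
  | zero =>
    have hsupp : (fun ω : ℕ → G.V => F (ω 0)).support ⊆ G.avoiding v 0 := by
      intro ω hω i hi heq
      rw [Nat.le_zero.1 hi] at heq
      exact hω ((congrArg F heq).trans hv)
    rw [Finset.range_zero, Finset.sum_empty, zero_add, setLIntegral_eq_of_support_subset hsupp,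
      ← lintegral_map (g := fun ω : ℕ → G.V => ω 0) .of_discrete (measurable_pi_apply 0),
      walkLaw_map_eval_zero, lintegral_dirac]
  | succ n ih =>
    rw [ih, Finset.sum_range_succ, add_assoc, setLIntegral_avoiding_eq_add hv hF]

/-- By induction on `n`, a solution exceeds `∑ k < n, P(T > k)` by `E[F(ω n); T > n]`, where `T` is
the first time at `v`; the excess is at most a constant times the general term of a convergent
series. -/
theorem hittingTime_eq_of_firstStep (hfin : ∀ x, F x ≠ ∞) (hv : F v = 0)
    (hF : ∀ x ≠ v, F x = 1 + ∫⁻ y, F y ∂(G.stepKernel x)) (u : G.V) :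
    G.hittingTime u v = F u := by
  set s : ℕ → ℝ≥0∞ := fun n => G.walkLaw u (G.avoiding v n)
  set r : ℕ → ℝ≥0∞ := fun n => ∫⁻ ω in G.avoiding v n, F (ω n) ∂(G.walkLaw u)
  have hsum (n : ℕ) : F u = ∑ k ∈ Finset.range n, s k + r n :=
    eq_sum_walkLaw_avoiding_add hv hF u n
  have hs : ∑' n, s n ≠ ∞ := by
    refine ne_top_of_le_ne_top (hfin u) ?_
    rw [ENNReal.tsum_eq_iSup_nat]
    exact iSup_le fun n => (hsum n).symm ▸ le_self_add
  have hr_le (n : ℕ) : r n ≤ (∑ x, F x) * s n := by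
    rw [← setLIntegral_const]
    exact lintegral_mono fun ω => Finset.single_le_sum (fun _ _ => zero_le) (Finset.mem_univ _)
  have hr : Filter.Tendsto r Filter.atTop (nhds 0) := by
    have hbound := ENNReal.Tendsto.const_mul (a := ∑ x, F x)
      (ENNReal.tendsto_atTop_zero_of_tsum_ne_top hs)
      (Or.inr (ENNReal.sum_ne_top.2 fun x _ => hfin x))
    rw [mul_zero] at hbound
    exact tendsto_of_tendsto_of_tendsto_of_le_of_le tendsto_const_nhds hbound
      (fun _ => zero_le) hr_le
  have hlim := (ENNReal.tendsto_nat_tsum s).add hr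
  simp only [← hsum, add_zero] at hlim
  rw [hittingTime_eq_tsum_walkLaw_avoiding]
  exact tendsto_nhds_unique hlim tendsto_const_nhds

open Classical in
theorem lintegral_stepKernel {x : G.V} (hx : (G.graph.neighborFinset x).Nonempty)
    (φ : G.V → ℝ≥0∞) :
    ∫⁻ y, φ y ∂(G.stepKernel x) = (G.deg x : ℝ≥0∞)⁻¹ * ∑ y ∈ G.graph.neighborFinset x, φ y := by
  have hpmf (y : G.V) : G.stepKernel x {y} =
      if y ∈ G.graph.neighborFinset x then (G.deg x : ℝ≥0∞)⁻¹ else 0 := by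
    rw [show G.stepKernel x {y} = G.stepLaw x y from
      PMF.toMeasure_apply_singleton _ _ (measurableSet_singleton _), stepLaw, dif_pos hx,
      PMF.uniformOfFinset_apply]
    rfl
  simp only [lintegral_fintype, hpmf, mul_ite, mul_zero, Finset.sum_ite_mem, Finset.univ_inter,
    ← Finset.sum_mul]
  rw [mul_comm]

end FirstStep

end FinGraph

/-! ### Hitting times on trees -/

section HittingTime

variable {V : Type*} {G : SimpleGraph V} {u v : V}

/-- The value of the hitting time from `u` to a neighbour `v` in a tree: one step for each
orientation of an edge on the side of `u`, except for `(u, v)`, which is counted once. -/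
noncomputable def edgeHittingTime (G : SimpleGraph V) (u v : V) : ℝ :=
  2 * (edgeSide G u v).ncard - 1

theorem edgeHittingTime_nonneg [Finite V] (hG : G.IsAcyclic) (h : G.Adj u v) :
    0 ≤ edgeHittingTime G u v := by
  have hpos : 0 < (edgeSide G u v).ncard :=
    (Set.ncard_pos).2 ⟨u, (isEdgeSide_edgeSide_of_isAcyclic hG h).left_mem⟩
  have hone : (1 : ℝ) ≤ (edgeSide G u v).ncard := by exact_mod_cast hpos
  rw [edgeHittingTime]
  linarith

variable [Fintype V] [DecidableRel G.Adj]

theorem sum_neighborFinset_pathSum_edgeHittingTime (hG : G.IsTree) (h : u ≠ v) :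
    ∑ x ∈ G.neighborFinset u, pathSum G (edgeHittingTime G) x v =
      G.degree u * (pathSum G (edgeHittingTime G) u v - 1) := by
  have hstep (x : V) (hx : x ∈ G.neighborFinset u) :
      pathSum G (edgeHittingTime G) x v = pathSum G (edgeHittingTime G) u v - 1 -
        (2 * Fintype.card V - 2) * (edgeSide G x u).indicator (1 : V → ℝ) v +
          2 * (edgeSide G x u).ncard := by
    have hadj : G.Adj u x := (G.mem_neighborFinset u x).1 hx
    have hcard := ncard_edgeSide_add hG hadj
    by_cases hv : v ∈ edgeSide G x u
    · rw [pathSum_eq_add hG hadj hv, Set.indicator_of_mem hv, edgeHittingTime, Pi.one_apply]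
      linarith
    · have hv' : v ∈ edgeSide G u x := by rwa [edgeSide_swap hG hadj.symm]
      rw [pathSum_eq_add hG hadj.symm hv', Set.indicator_of_notMem hv, edgeHittingTime]
      ring
  rw [Finset.sum_congr rfl hstep, Finset.sum_add_distrib, Finset.sum_sub_distrib, ← Finset.mul_sum,
    ← Finset.mul_sum, sum_neighborFinset_indicator_edgeSide hG h.symm,
    sum_neighborFinset_ncard_edgeSide hG, Finset.sum_const, G.card_neighborFinset_eq_degree,
    nsmul_eq_mul]
  ring

theorem sum_pathSum_edgeHittingTime (hG : G.IsTree) :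
    ∑ u, ∑ v, pathSum G (edgeHittingTime G) u v =
      (Fintype.card V - 1) * ∑ u, ∑ v, (G.dist u v : ℝ) := by
  have hsymm : ∑ u, ∑ v, pathSum G (edgeHittingTime G) u v =
      ∑ d : G.Dart, edgeSplit G d.fst d.snd * edgeHittingTime G d.snd d.fst := by
    rw [sum_pathSum, ← Equiv.sum_comp (SimpleGraph.Dart.symm_involutive.toPerm _)]
    exact Finset.sum_congr rfl fun d _ => congrArg (· * _) (edgeSplit_comm _ _ _)
  have htwo : 2 * ∑ u, ∑ v, pathSum G (edgeHittingTime G) u v =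
      2 * ((Fintype.card V - 1) * ∑ u, ∑ v, pathSum G (fun _ _ => 1) u v) := by
    rw [two_mul]
    nth_rw 1 [hsymm]
    rw [sum_pathSum, sum_pathSum, ← Finset.sum_add_distrib, Finset.mul_sum, Finset.mul_sum]
    refine Finset.sum_congr rfl fun d _ => ?_
    rw [← ncard_edgeSide_add hG d.adj, edgeHittingTime, edgeHittingTime]
    ring
  simp only [← pathSum_one_eq_dist hG]
  exact mul_left_cancel₀ two_ne_zero htwo

end HittingTime

namespace FinGraph

section Tree

variable {G : FinGraph.{u}}

open Classical in
theorem wiener_eq_sum_dart (hG : G.graph.IsTree) :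
    G.wiener = 1 / 2 * ∑ d : G.graph.Dart, edgeSplit G.graph d.fst d.snd := by
  simp only [wiener, ← pathSum_one_eq_dist hG, sum_pathSum, mul_one]

open Classical in
theorem hittingTime_eq_pathSum (hG : G.graph.IsTree) (u v : G.V) :
    G.hittingTime u v = ENNReal.ofReal (pathSum G.graph (edgeHittingTime G.graph) u v) := by
  have hnonneg (x : G.V) : 0 ≤ pathSum G.graph (edgeHittingTime G.graph) x v :=
    pathSum_nonneg (fun _ _ => edgeHittingTime_nonneg hG.isAcyclic) x v
  refine hittingTime_eq_of_firstStep (F := fun x => ENNReal.ofReal (pathSum _ _ x v))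
    (fun _ => ENNReal.ofReal_ne_top) (by rw [pathSum_self hG, ENNReal.ofReal_zero]) ?_ u
  intro x hx
  obtain ⟨y, ⟨hadj, -⟩, -⟩ := existsUnique_adj_mem_edgeSide hG hx.symm
  have hdeg : (0 : ℝ) < G.deg x :=
    Nat.cast_pos.2 ((G.graph.degree_pos_iff_exists_adj x).2 ⟨y, hadj⟩)
  have hharm : pathSum G.graph (edgeHittingTime G.graph) x v = 1 + (G.deg x : ℝ)⁻¹ *
      ∑ y ∈ G.graph.neighborFinset x, pathSum G.graph (edgeHittingTime G.graph) y v := by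
    rw [sum_neighborFinset_pathSum_edgeHittingTime hG hx, ← deg, inv_mul_cancel_left₀ hdeg.ne']
    ring
  rw [lintegral_stepKernel ⟨y, (G.graph.mem_neighborFinset x y).2 hadj⟩, hharm,
    ENNReal.ofReal_add zero_le_one (mul_nonneg (by positivity)
      (Finset.sum_nonneg fun y _ => hnonneg y)), ENNReal.ofReal_mul (by positivity),
    ENNReal.ofReal_sum_of_nonneg fun y _ => hnonneg y, ENNReal.ofReal_one,
    ENNReal.ofReal_inv_of_pos hdeg, ENNReal.ofReal_natCast]

theorem meanHittingTime_of_isTree (hG : G.graph.IsTree) :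
    G.meanHittingTime = 2 / (G.order : ℝ) * G.wiener := by
  classical
  have hsum : ∑ u, ∑ v, (G.hittingTime u v).toReal =
      ((G.order : ℝ) - 1) * ∑ u, ∑ v, (G.graph.dist u v : ℝ) := by
    rw [order, ← sum_pathSum_edgeHittingTime hG]
    simp only [hittingTime_eq_pathSum hG]
    exact Finset.sum_congr rfl fun u _ => Finset.sum_congr rfl fun v _ => ENNReal.toReal_ofReal
      (pathSum_nonneg (fun _ _ => edgeHittingTime_nonneg hG.isAcyclic) u v)
  rw [meanHittingTime, hsum, wiener]
  rcases eq_or_ne (G.order : ℝ) 1 with hone | hne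
  · have : Subsingleton G.V := Fintype.card_le_one_iff_subsingleton.1 (by exact_mod_cast hone.le)
    have hdist (u v : G.V) : G.graph.dist u v = 0 := by
      rw [Subsingleton.elim u v, SimpleGraph.dist_self]
    simp [hdist]
  · rw [mul_comm (G.order : ℝ), mul_div_mul_left _ _ (sub_ne_zero.2 hne)]
    ring

end Tree

end FinGraph

/-! ### Finite sums -/

theorem sum_dart {V M : Type*} [Fintype V] (G : SimpleGraph V) [DecidableRel G.Adj]
    [AddCommMonoid M] (f : V → V → M) :
    ∑ d : G.Dart, f d.fst d.snd = ∑ u, ∑ v ∈ G.neighborFinset u, f u v := by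
  rw [Finset.sum_sigma']
  refine Finset.sum_bij' (fun d _ => ⟨d.fst, d.snd⟩)
    (fun p hp => ⟨(p.1, p.2), by simpa using hp⟩) ?_ ?_ ?_ ?_ ?_ <;> simp [SimpleGraph.Dart.adj]

theorem sum_range_succ_pow_mul_reflect {R : Type*} [CommSemiring R] (r : R) (a : ℕ → R) (t : ℕ) :
    ∑ i ∈ Finset.range (t + 1), r ^ i * a (t + 1 - 1 - i) =
      a t + r * ∑ i ∈ Finset.range t, r ^ i * a (t - 1 - i) := by
  rw [Finset.sum_range_succ', Finset.mul_sum, add_comm, pow_zero, one_mul]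
  refine congrArg _ (Finset.sum_congr rfl fun i _ => ?_)
  rw [show t + 1 - 1 - (i + 1) = t - 1 - i by lia, pow_succ', mul_assoc]

/-! ### The V-fractal operation on trees -/

namespace FinGraph

section VOp

variable {G : FinGraph.{u}} {m : ℕ}

/-- The old vertex next to which a vertex is placed by the V-fractal operation (an old vertex is
placed at itself). -/
def vRoot : VVertex G m → G.V
  | .old u => u
  | .mid d => d.fst
  | .leaf u _ => u

theorem isEdgeSide_preimage_vRoot {d : G.graph.Dart} {A : Set G.V}
    (hA : IsEdgeSide G.graph d.fst d.snd A) :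
    IsEdgeSide (G.vGraph m) (.mid d) (.mid d.symm) (vRoot ⁻¹' A) where
  left_mem := hA.left_mem
  right_notMem := hA.right_notMem
  eq_of_exit := by
    rintro (u | e | ⟨u, i⟩) (v | e' | ⟨v, j⟩) hadj hp hq <;>
      simp only [vGraph, VAdj] at hadj <;> subst hadj
    case mid.mid =>
      have he : e = d := SimpleGraph.Dart.ext _ _ (Prod.ext_iff.2 (hA.eq_of_exit e.adj hp hq))
      rw [he]
      exact ⟨rfl, rfl⟩
    all_goals exact absurd hp hq

theorem isEdgeSide_preimage_vRoot_diff {d : G.graph.Dart} {A : Set G.V}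
    (hA : IsEdgeSide G.graph d.fst d.snd A) :
    IsEdgeSide (G.vGraph m) (.old d.fst) (.mid d) (vRoot ⁻¹' A \ {.mid d}) where
  left_mem := ⟨hA.left_mem, nofun⟩
  right_notMem h := h.2 rfl
  eq_of_exit := by
    intro p q hadj hp hq
    have hroot : vRoot q ∈ A := by_contra fun hqA =>
      hp.2 ((isEdgeSide_preimage_vRoot hA).eq_of_exit hadj hp.1 hqA).1
    obtain rfl : q = .mid d := by_contra fun hne => hq ⟨hroot, hne⟩
    rcases p with u | e | ⟨u, i⟩ <;> simp only [vGraph, VAdj] at hadj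
    · exact ⟨congrArg _ hadj.symm, rfl⟩
    · subst hadj
      exact absurd hp.1 hA.right_notMem

theorem isEdgeSide_singleton_leaf (u : G.V) (i : Fin (m - G.deg u)) :
    IsEdgeSide (G.vGraph m) (.leaf u i) (.old u) {.leaf u i} where
  left_mem := rfl
  right_notMem := nofun
  eq_of_exit := by
    rintro p (v | e | ⟨v, j⟩) hadj rfl - <;> simp only [vGraph, VAdj] at hadj
    exact ⟨rfl, congrArg _ hadj⟩

theorem isAcyclic_vGraph (hG : G.graph.IsAcyclic) : (G.vGraph m).IsAcyclic := by
  have hside (d : G.graph.Dart) := isEdgeSide_edgeSide_of_isAcyclic hG d.adj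
  have hold (d : G.graph.Dart) := (isEdgeSide_preimage_vRoot_diff (m := m) (hside d)).isBridge
  have hleaf (u : G.V) (i : Fin (m - G.deg u)) := (isEdgeSide_singleton_leaf u i).isBridge
  rw [SimpleGraph.isAcyclic_iff_forall_adj_isBridge]
  rintro (u | d | ⟨u, i⟩) (v | e | ⟨v, j⟩) hadj <;> simp only [vGraph, VAdj] at hadj <;> subst hadj
  · exact hold e
  · exact Sym2.eq_swap ▸ hleaf u j
  · exact Sym2.eq_swap ▸ hold d
  · exact (isEdgeSide_preimage_vRoot (hside d)).isBridge
  · exact hleaf v i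

theorem connected_vGraph (hG : G.graph.Connected) : (G.vGraph m).Connected := by
  have hroot (x : VVertex G m) : (G.vGraph m).Reachable (.old (vRoot x)) x := by
    rcases x with u | d | ⟨u, i⟩
    · rfl
    · exact SimpleGraph.Adj.reachable (G := G.vGraph m) (show d.fst = d.fst from rfl)
    · exact SimpleGraph.Adj.reachable (G := G.vGraph m) (show u = u from rfl)
  have hadj {u v : G.V} (h : G.graph.Adj u v) : (G.vGraph m).Reachable (.old u) (.old v) := by
    let d : G.graph.Dart := ⟨(u, v), h⟩
    have hmid : (G.vGraph m).Adj (.mid d) (.mid d.symm) := rfl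
    exact (hroot (.mid d)).trans (hmid.reachable.trans (hroot (.mid d.symm)).symm)
  have hold (u v : G.V) : (G.vGraph m).Reachable (.old u) (.old v) := by
    obtain ⟨p⟩ := hG.preconnected u v
    induction p with
    | nil => rfl
    | cons h _ ih => exact (hadj h).trans ih
  obtain ⟨u⟩ := hG.nonempty
  exact SimpleGraph.connected_iff_exists_forall_reachable _ |>.2
    ⟨.old u, fun x => (hold u (vRoot x)).trans (hroot x)⟩

theorem isTree_vOp (hG : G.graph.IsTree) (m : ℕ) : (vOp m G).graph.IsTree :=
  ⟨connected_vGraph hG.connected, isAcyclic_vGraph hG.isAcyclic⟩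

/-! ### The Wiener index after a V-fractal operation -/

open Classical in
theorem sum_vVertex {M : Type*} [AddCommMonoid M] (f : VVertex G m → M) :
    ∑ x, f x = ∑ u, f (.old u) + (∑ d, f (.mid d) + ∑ u, ∑ i, f (.leaf u i)) := by
  rw [← (G.vVertexEquiv m).symm.sum_comp f, Fintype.sum_sum_type, Fintype.sum_sum_type,
    Fintype.sum_sigma]
  rfl

open Classical in
theorem sum_dart_vGraph {M : Type*} [AddCommMonoid M] (f : VVertex G m → VVertex G m → M) :
    ∑ e : (G.vGraph m).Dart, f e.fst e.snd =
      ∑ d : G.graph.Dart,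
        (f (.old d.fst) (.mid d) + f (.mid d) (.old d.fst) + f (.mid d) (.mid d.symm)) +
      ∑ u, ∑ i, (f (.old u) (.leaf u i) + f (.leaf u i) (.old u)) := by
  have adj_old_mid (u d) : (G.vGraph m).Adj (.old u) (.mid d) ↔ d.fst = u := .rfl
  have adj_mid_old (d u) : (G.vGraph m).Adj (.mid d) (.old u) ↔ d.fst = u := .rfl
  have adj_mid_mid (d e) : (G.vGraph m).Adj (.mid d) (.mid e) ↔ e = d.symm := .rfl
  have adj_old_leaf (u v i) : (G.vGraph m).Adj (.old u) (.leaf v i) ↔ u = v := .rfl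
  have adj_leaf_old (v i u) : (G.vGraph m).Adj (.leaf v i) (.old u) ↔ u = v := .rfl
  rw [sum_dart]
  simp only [SimpleGraph.neighborFinset_eq_filter, Finset.sum_filter, sum_vVertex, adj_old_mid,
    adj_mid_old, adj_mid_mid, adj_old_leaf, adj_leaf_old]
  have hold : ∑ u, ∑ d : G.graph.Dart, (if d.fst = u then f (.old u) (.mid d) else 0) =
      ∑ d : G.graph.Dart, f (.old d.fst) (.mid d) := by
    rw [Finset.sum_comm]
    simp only [Finset.sum_ite_eq, Finset.mem_univ, if_true]
  simp only [vGraph, VAdj, ↓reduceIte, Finset.sum_const_zero, Finset.sum_ite_irrel,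
    Finset.sum_ite_eq, Finset.sum_ite_eq', Finset.mem_univ, zero_add, add_zero,
    Finset.sum_add_distrib, hold]
  abel

theorem sum_vRoot (hm : VApplicable m G) (f : G.V → ℝ) :
    ∑ x : VVertex G m, f (vRoot x) = (m + 1) * ∑ u, f u := by
  classical
  rw [sum_vVertex, Finset.mul_sum]
  simp only [vRoot]
  rw [sum_dart G.graph fun u _ => f u, ← Finset.sum_add_distrib, ← Finset.sum_add_distrib]
  refine Finset.sum_congr rfl fun u _ => ?_
  rw [Finset.sum_const, Finset.sum_const, SimpleGraph.card_neighborFinset_eq_degree,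
    Finset.card_univ, Fintype.card_fin, ← deg, nsmul_eq_mul, nsmul_eq_mul, Nat.cast_sub (hm u)]
  ring

theorem order_vOp (hm : VApplicable m G) : (vOp m G).order = G.order * (m + 1) := by
  have hsum := sum_vRoot hm fun _ => 1
  simp only [Finset.sum_const, Finset.card_univ, nsmul_one] at hsum
  rw [mul_comm]
  exact_mod_cast hsum

theorem ncard_preimage_vRoot (hm : VApplicable m G) (A : Set G.V) :
    ((vRoot (m := m) ⁻¹' A).ncard : ℝ) = (m + 1) * A.ncard := by
  rw [← sum_indicator_one, ← sum_indicator_one, ← sum_vRoot hm]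
  rfl

open Classical in
theorem sum_deg (hG : G.graph.IsTree) : ∑ u, (G.deg u : ℝ) = 2 * (G.order - 1) := by
  have hedge : ∑ u, G.deg u = 2 * G.graph.edgeFinset.card := G.graph.sum_degrees_eq_twice_card_edges
  have hcard : G.graph.edgeFinset.card + 1 = G.order := hG.card_edgeFinset
  rw [← hcard]
  push_cast
  rw [add_sub_cancel_right]
  exact_mod_cast hedge

theorem sum_leaf (hG : G.graph.IsTree) (hm : VApplicable m G) (c : ℝ) :
    ∑ u, ∑ _i : Fin (m - G.deg u), c = (m * G.order - 2 * (G.order - 1)) * c := by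
  simp only [Finset.sum_const, Finset.card_univ, Fintype.card_fin, nsmul_eq_mul,
    Nat.cast_sub (hm _)]
  rw [← Finset.sum_mul, Finset.sum_sub_distrib, sum_deg hG, Finset.sum_const, nsmul_eq_mul,
    Finset.card_univ, ← order, mul_comm (m : ℝ)]

open Classical in
theorem sum_dart_ncard_edgeSide_sub (G : FinGraph.{u}) :
    ∑ d : G.graph.Dart, (((edgeSide G.graph d.fst d.snd).ncard : ℝ) -
      (edgeSide G.graph d.snd d.fst).ncard) = 0 := by
  rw [Finset.sum_sub_distrib, sub_eq_zero,
    ← Equiv.sum_comp (SimpleGraph.Dart.symm_involutive.toPerm _)]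
  rfl

theorem edgeSplit_vGraph (hG : G.graph.Connected) (hm : VApplicable m G) {x y : VVertex G m}
    {S : Set (VVertex G m)} (hS : IsEdgeSide (G.vGraph m) x y S) :
    edgeSplit (G.vGraph m) x y = S.ncard * ((m + 1) * G.order - S.ncard) := by
  have hcard : (Fintype.card (VVertex G m) : ℝ) = (m + 1) * G.order := by
    rw [mul_comm]
    exact_mod_cast order_vOp hm
  rw [hS.edgeSplit_eq (connected_vGraph hG).preconnected, hcard]

theorem edgeSplit_mid_mid_symm (hG : G.graph.IsTree) (hm : VApplicable m G) (d : G.graph.Dart) :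
    edgeSplit (G.vGraph m) (.mid d) (.mid d.symm) =
      (m + 1) ^ 2 * edgeSplit G.graph d.fst d.snd := by
  have hside := isEdgeSide_edgeSide_of_isAcyclic hG.isAcyclic d.adj
  rw [edgeSplit_vGraph hG.connected hm (isEdgeSide_preimage_vRoot hside),
    ncard_preimage_vRoot hm, hside.edgeSplit_eq hG.connected.preconnected, ← order]
  ring

theorem edgeSplit_old_mid (hG : G.graph.IsTree) (hm : VApplicable m G) (d : G.graph.Dart) :
    edgeSplit (G.vGraph m) (.old d.fst) (.mid d) =
      (m + 1) ^ 2 * edgeSplit G.graph d.fst d.snd - 1 + (m + 1) *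
        ((edgeSide G.graph d.fst d.snd).ncard - (edgeSide G.graph d.snd d.fst).ncard) := by
  have hside := isEdgeSide_edgeSide_of_isAcyclic hG.isAcyclic d.adj
  have hmem : VVertex.mid d ∈ vRoot (m := m) ⁻¹' edgeSide G.graph d.fst d.snd := hside.left_mem
  have hcard : ((vRoot (m := m) ⁻¹' edgeSide G.graph d.fst d.snd \ {.mid d}).ncard : ℝ) =
      (m + 1) * (edgeSide G.graph d.fst d.snd).ncard - 1 := by
    rw [← ncard_preimage_vRoot hm, ← Set.ncard_sdiff_singleton_add_one hmem, Nat.cast_succ,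
      add_sub_cancel_right]
  rw [edgeSplit_vGraph hG.connected hm (isEdgeSide_preimage_vRoot_diff hside), hcard, order,
    ← ncard_edgeSide_add hG d.adj, edgeSplit]
  ring

theorem edgeSplit_leaf_old (hG : G.graph.Connected) (hm : VApplicable m G) (u : G.V)
    (i : Fin (m - G.deg u)) :
    edgeSplit (G.vGraph m) (.leaf u i) (.old u) = (m + 1) * G.order - 1 := by
  rw [edgeSplit_vGraph hG hm (isEdgeSide_singleton_leaf u i), Set.ncard_singleton, Nat.cast_one,
    one_mul]

theorem wiener_vOp (hG : G.graph.IsTree) (hm : VApplicable m G) :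
    (vOp m G).wiener = 3 * ((m : ℝ) + 1) ^ 2 * G.wiener
      + ((m : ℝ) - 2) * (m + 1) * (G.order : ℝ) ^ 2 + ((m : ℝ) + 2) * G.order := by
  classical
  have hdart (d : G.graph.Dart) :
      edgeSplit (G.vGraph m) (.old d.fst) (.mid d) + edgeSplit (G.vGraph m) (.mid d) (.old d.fst) +
          edgeSplit (G.vGraph m) (.mid d) (.mid d.symm) =
        3 * (m + 1) ^ 2 * edgeSplit G.graph d.fst d.snd - 2 + 2 * (m + 1) *
          ((edgeSide G.graph d.fst d.snd).ncard - (edgeSide G.graph d.snd d.fst).ncard) := by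
    rw [edgeSplit_comm (G.vGraph m) (.mid d) (.old d.fst), edgeSplit_old_mid hG hm,
      edgeSplit_mid_mid_symm hG hm]
    ring
  have hleaf (u : G.V) (i : Fin (m - G.deg u)) :
      edgeSplit (G.vGraph m) (.old u) (.leaf u i) + edgeSplit (G.vGraph m) (.leaf u i) (.old u) =
        2 * ((m + 1) * G.order - 1) := by
    rw [edgeSplit_comm (G.vGraph m) (.old u), edgeSplit_leaf_old hG.connected hm, two_mul]
  have hcard : (Fintype.card G.graph.Dart : ℝ) = 2 * (G.order - 1) := by
    rw [G.graph.dart_card_eq_sum_degrees, ← sum_deg hG]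
    push_cast
    rfl
  have hsum : (vOp m G).wiener = 1 / 2 * ∑ e : (G.vGraph m).Dart,
      edgeSplit (G.vGraph m) e.fst e.snd := wiener_eq_sum_dart (isTree_vOp hG m)
  rw [hsum, sum_dart_vGraph]
  simp only [hdart, hleaf]
  rw [sum_leaf hG hm, Finset.sum_add_distrib, Finset.sum_sub_distrib, ← Finset.mul_sum,
    ← Finset.mul_sum, sum_dart_ncard_edgeSide_sub, wiener_eq_sum_dart hG, Finset.sum_const,
    Finset.card_univ, nsmul_eq_mul, hcard]
  ring

end VOp

/-! ### Iteration -/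

theorem isTree_vFractal {T : FinGraph.{u}} (hT : T.graph.IsTree) (m t : ℕ) :
    (vFractal m T t).graph.IsTree := by
  induction t with
  | zero => exact hT
  | succ t ih => exact isTree_vOp ih m

theorem order_vFractal {T : FinGraph.{u}} {m t : ℕ}
    (hm : ∀ s < t, VApplicable m (vFractal m T s)) :
    (vFractal m T t).order = T.order * (m + 1) ^ t := by
  induction t with
  | zero => rw [vFractal, pow_zero, mul_one]
  | succ t ih =>
    rw [vFractal, order_vOp (hm t t.lt_succ_self), ih fun s hs => hm s (hs.trans t.lt_succ_self),
      pow_succ, mul_assoc]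

theorem wiener_vFractal {T : FinGraph.{u}} (hT : T.graph.IsTree) {m t : ℕ}
    (hm : ∀ s < t, VApplicable m (vFractal m T s)) :
    (vFractal m T t).wiener = (3 * ((m : ℝ) + 1) ^ 2) ^ t * T.wiener
      + ((m : ℝ) - 2) * ((m : ℝ) + 1) *
        ∑ i ∈ Finset.range t, (3 * ((m : ℝ) + 1) ^ 2) ^ i *
          ((vFractal m T (t - 1 - i)).order : ℝ) ^ 2
      + ((m : ℝ) + 2) *
        ∑ i ∈ Finset.range t, (3 * ((m : ℝ) + 1) ^ 2) ^ i *
          ((vFractal m T (t - 1 - i)).order : ℝ) := by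
  induction t with
  | zero => simp [vFractal]
  | succ t ih =>
    rw [vFractal, wiener_vOp (isTree_vFractal hT m t) (hm t t.lt_succ_self),
      ih fun s hs => hm s (hs.trans t.lt_succ_self),
      sum_range_succ_pow_mul_reflect _ fun s => ((vFractal m T s).order : ℝ) ^ 2,
      sum_range_succ_pow_mul_reflect _ fun s => ((vFractal m T s).order : ℝ)]
    ring

end FinGraph

theorem propositionI14 (T : FinGraph.{u}) (hT : T.graph.IsTree) (m t : ℕ)
    (hm : ∀ s < t, FinGraph.VApplicable m (FinGraph.vFractal m T s)) :
    (FinGraph.vFractal m T t).order = T.order * (m + 1) ^ t ∧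
    (∀ u v, (FinGraph.vFractal m T t).hittingTime u v ≠ ⊤) ∧
    (FinGraph.vFractal m T t).meanHittingTime =
      2 / ((FinGraph.vFractal m T t).order : ℝ) *
        ((3 * ((m : ℝ) + 1) ^ 2) ^ t * T.wiener
          + ((m : ℝ) - 2) * ((m : ℝ) + 1) *
            ∑ i ∈ Finset.range t, (3 * ((m : ℝ) + 1) ^ 2) ^ i *
              ((FinGraph.vFractal m T (t - 1 - i)).order : ℝ) ^ 2
          + ((m : ℝ) + 2) *
            ∑ i ∈ Finset.range t, (3 * ((m : ℝ) + 1) ^ 2) ^ i *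
              ((FinGraph.vFractal m T (t - 1 - i)).order : ℝ)) := by
  have hV := FinGraph.isTree_vFractal hT m t
  refine ⟨FinGraph.order_vFractal hm, fun u v => ?_, ?_⟩
  · rw [FinGraph.hittingTime_eq_pathSum hV]
    exact ENNReal.ofReal_ne_top
  · rw [FinGraph.meanHittingTime_of_isTree hV, FinGraph.wiener_vFractal hT hm]
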